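/- Let $A$ be a finite set of arms with mutually independent integrable real rewards $(X(a))_{a\in A}$ and means $\mu(a)=\mathbb E[X(a)]\neq 0$. For $s\subseteq A$ let $\mathrm{above}(s)=\{a\in s:\mu(a)>0\}$ and $\mathrm{neg}(s)=\{a\in s:\mu(a)<0\}$. Assume that the rewards of the arms in $\mathrm{neg}(A)$ are stochastically ordered: for any two arms $a,b\in\mathrm{neg}(A)$, either $\Pr(X(a)\ge x)\ge\Pr(X(b)\ge x)$ for all $x\in\mathbb R$, or the reverse inequality holds for all $x\in\mathbb R$. Consider the goal Markov decision process whose states are the sets $s\subseteq A$ of unobserved arms. The actions at $s$ are the portfolios in $\mathrm{MIR}(s)=\{p\in\Delta(s):\sum_{a\in s}p(a)\mu(a)\ge 0\}$, where $\Delta(s)$ is the set of probability distributions on $s$; choosing $p$ leads to $s\setminus\{a\}$ with probability $p(a)$. A state $s$ is terminal if $\mathrm{MIR}(s)=\emptyset$, and then it pays the expected reward $R(s)=\mathbb E\big[\max_{a\in A}X(a)\cdot\mathbf 1\{\exists a'\in A\setminus s:\ X(a')>0\}\big]$ (which is $0$ if $A\setminus s=\emptyset$). A stationary policy $\pi$ assigns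 to every non-terminal $s$ a portfolio $\pi(s)\in\mathrm{MIR}(s)$. Its value is $W(\pi,s)=R(s)$ if $s$ is terminal, and $W(\pi,s)=\sum_{a\in s}\pi(s)(a)\,W(\pi,s\setminus\{a\})$ otherwise. Let $W^\star(s)=\sup_\pi W(\pi,s)$. For $i\in\mathrm{above}(A)$ and $j\in\mathrm{neg}(A)$ let $p_{i,j}$ be the portfolio with $p_{i,j}(i)=\frac{-\mu(j)}{\mu(i)-\mu(j)}$ and $p_{i,j}(j)=\frac{\mu(i)}{\mu(i)-\mu(j)}$, and let $p_{i,i}$ select $i$ with probability one. A policy $\pi$ is $\mathcal P$-valid if at every non-terminal $s$ the portfolio $\pi(s)\in\mathrm{MIR}(s)$ is of the form $p_{i,j}$ with $i\in\mathrm{above}(A)$, $j\in\mathrm{neg}(A)$ when $\mathrm{neg}(s)\ne\emptyset$, and of the form $p_{i,i}$ with $i\in\mathrm{above}(A)$ when $\mathrm{neg}(s)=\emptyset$. The policy OGP picks, at every non-terminal $s$, an arbitrary $i\in\mathrm{above}(s)$; it selects $p_{i,i}$ if $\mathrm{neg}(s)=\emptyset$, and otherwise $p_{i,j^\star}$ for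 some $j^\star\in\arg\max_{j\in\mathrm{neg}(s)}\mu(j)$ (ties broken arbitrarily). Then: 1. OGP policies exist, and every OGP policy is $\mathcal P$-valid and optimal: $W(\mathrm{OGP},A)=W^\star(A)$, and moreover $W(\mathrm{OGP},s)=W^\star(s)$ for every $s\subseteq A$. 2. Let $\sigma:\mathrm{neg}(A)\to\{1,\dots,|\mathrm{neg}(A)|\}$ be a bijection that lists $\mathrm{neg}(A)$ in order of decreasing (non-increasing) mean. Let $\pi^\star$ be a $\mathcal P$-valid policy that is right-ordered by $\sigma$: at every non-terminal $s$ with $\mathrm{neg}(s)\neq\emptyset$ it selects $p_{i,j^\star}$ for some $i\in\mathrm{above}(s)$ and the $\sigma$-minimal $j^\star\in\mathrm{neg}(s)$. Then $W(\pi^\star,s)=W^\star(s)$ for every $s\subseteq A$. In both parts all the suprema are finite, and they equal the suprema over history-dependent policies, i.e. policies that choose a portfolio in $\mathrm{MIR}(s)$ depending also on the previously visited states and the portfolios chosen there. -/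

import Mathlib

open MeasureTheory ProbabilityTheory

noncomputable section

namespace GMDP

variable {ι Ω : Type*} [Fintype ι] [DecidableEq ι] [MeasurableSpace Ω]

/-! The arms are the elements of the finite type `ι` (so the set of all arms is `Finset.univ`),
and `X a` is the random reward of arm `a` on the probability space `(Ω, P)`. -/

/-- The prior mean of arm `a`. -/
def mean (P : Measure Ω) (X : ι → Ω → ℝ) (a : ι) : ℝ := ∫ ω, X a ω ∂P

/-- The arms of `s` with positive mean. -/
def above (P : Measure Ω) (X : ι → Ω → ℝ) (s : Finset ι) : Finset ι :=
  s.filter fun a => 0 < mean P X a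

/-- The arms of `s` with negative mean. -/
def neg (P : Measure Ω) (X : ι → Ω → ℝ) (s : Finset ι) : Finset ι :=
  s.filter fun a => mean P X a < 0

/-- First-order stochastic dominance of `Y` over `Z`. -/
def StochDominates (P : Measure Ω) (Y Z : Ω → ℝ) : Prop :=
  ∀ x : ℝ, P {ω | x ≤ Z ω} ≤ P {ω | x ≤ Y ω}

/-- The rewards of the arms with negative mean are stochastically ordered: any two of them are
comparable for first-order stochastic dominance. -/
def NegStochOrdered (P : Measure Ω) (X : ι → Ω → ℝ) : Prop :=
  ∀ a ∈ neg P X Finset.univ, ∀ b ∈ neg P X Finset.univ,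
    StochDominates P (X a) (X b) ∨ StochDominates P (X b) (X a)

/-- The MIR portfolios at the state `s` (the set of unobserved arms): probability vectors
supported on `s` with nonnegative expected reward. -/
def MIR (P : Measure Ω) (X : ι → Ω → ℝ) (s : Finset ι) : Set (ι → ℝ) :=
  {p | p ∈ stdSimplex ℝ ι ∧ (∀ a ∉ s, p a = 0) ∧ 0 ≤ ∑ a ∈ s, p a * mean P X a}

/-- A state is terminal if it has no MIR portfolio. -/
def Terminal (P : Measure Ω) (X : ι → Ω → ℝ) (s : Finset ι) : Prop := MIR P X s = ∅

open Classical in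
/-- Realized reward upon termination at `s`: the maximal reward of all arms if some explored arm
(an arm outside `s`) has positive reward, and `0` otherwise. In the first case there is at least
one arm, so that the supremum is a maximum over a finite nonempty family. -/
def realizedReward (X : ι → Ω → ℝ) (s : Finset ι) (ω : Ω) : ℝ :=
  if ∃ a, a ∉ s ∧ 0 < X a ω then ⨆ a, X a ω else 0

/-- Expected reward `R(s)` of the terminal state `s`. -/
def reward (P : Measure Ω) (X : ι → Ω → ℝ) (s : Finset ι) : ℝ :=
  ∫ ω, realizedReward X s ω ∂P

/-- Stationary policies: maps from states to portfolios. Values at terminal states are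
irrelevant. -/
abbrev Policy (ι : Type*) := Finset ι → ι → ℝ

/-- Histories: lists of pairs of a visited state and the portfolio selected there (most recent
pair first). -/
abbrev History (ι : Type*) := List (Finset ι × (ι → ℝ))

/-- History-dependent policies. -/
abbrev HPolicy (ι : Type*) := History ι → Finset ι → ι → ℝ

/-- A stationary policy is MIR if it selects MIR portfolios at all non-terminal states. -/
def IsMIR (P : Measure Ω) (X : ι → Ω → ℝ) (π : Policy ι) : Prop :=
  ∀ s, ¬ Terminal P X s → π s ∈ MIR P X s

/-- A history-dependent policy is MIR if, after every history, it selects MIR portfolios at all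
non-terminal states. -/
def IsMIRH (P : Measure Ω) (X : ι → Ω → ℝ) (π : HPolicy ι) : Prop :=
  ∀ h s, ¬ Terminal P X s → π h s ∈ MIR P X s

open Classical in
/-- The state-value function `W(π, s)` of a stationary policy. -/
def W (P : Measure Ω) (X : ι → Ω → ℝ) (π : Policy ι) (s : Finset ι) : ℝ :=
  if Terminal P X s then reward P X s
  else ∑ a : s, π s a * W P X π (s.erase a)
termination_by s.card
decreasing_by exact Finset.card_erase_lt_of_mem a.2

open Classical in
/-- The value `W(π, h, s)` of a history-dependent policy at the state `s` after the
history `h`. -/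
def WH (P : Measure Ω) (X : ι → Ω → ℝ) (π : HPolicy ι) (h : History ι) (s : Finset ι) : ℝ :=
  if Terminal P X s then reward P X s
  else ∑ a : s, π h s a * WH P X π ((s, π h s) :: h) (s.erase a)
termination_by s.card
decreasing_by exact Finset.card_erase_lt_of_mem a.2

/-- The values at `s` of all stationary MIR policies. -/
def values (P : Measure Ω) (X : ι → Ω → ℝ) (s : Finset ι) : Set ℝ :=
  {w | ∃ π : Policy ι, IsMIR P X π ∧ W P X π s = w}

/-- The values at `s`, from the empty history, of all history-dependent MIR policies. -/
def valuesH (P : Measure Ω) (X : ι → Ω → ℝ) (s : Finset ι) : Set ℝ :=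
  {w | ∃ π : HPolicy ι, IsMIRH P X π ∧ WH P X π [] s = w}

/-- The optimal value `W⋆(s)` over stationary MIR policies. -/
def WStar (P : Measure Ω) (X : ι → Ω → ℝ) (s : Finset ι) : ℝ := sSup (values P X s)

/-- The optimal value over history-dependent MIR policies. -/
def WStarH (P : Measure Ω) (X : ι → Ω → ℝ) (s : Finset ι) : ℝ := sSup (valuesH P X s)

/-- The policy `π` attains the optimal value from `s`, among stationary and also among
history-dependent MIR policies. The suprema are over sets that are bounded above. -/
def OptimalFrom (P : Measure Ω) (X : ι → Ω → ℝ) (π : Policy ι) (s : Finset ι) : Prop :=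
  BddAbove (values P X s) ∧ BddAbove (valuesH P X s) ∧
    W P X π s = WStar P X s ∧ W P X π s = WStarH P X s

/-- The portfolio `p_{i,j}` mixing `i` (positive mean) with `j` (negative mean), with the maximal
MIR probability on `j`. -/
def mix (P : Measure Ω) (X : ι → Ω → ℝ) (i j : ι) : ι → ℝ := fun a =>
  if a = i then -mean P X j / (mean P X i - mean P X j)
  else if a = j then mean P X i / (mean P X i - mean P X j)
  else 0

/-- The portfolio `p_{i,i}` selecting `i` with probability one. -/
def single (i : ι) : ι → ℝ := fun a => if a = i then 1 else 0

/-- `p` is a `𝒫`-valid portfolio at the state `s`. -/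
def PValidPortfolio (P : Measure Ω) (X : ι → Ω → ℝ) (s : Finset ι) (p : ι → ℝ) : Prop :=
  p ∈ MIR P X s ∧
    ((neg P X s).Nonempty →
      ∃ i ∈ above P X Finset.univ, ∃ j ∈ neg P X Finset.univ, p = mix P X i j) ∧
    (neg P X s = ∅ → ∃ i ∈ above P X Finset.univ, p = single i)

/-- A policy is `𝒫`-valid if it selects `𝒫`-valid portfolios at all non-terminal states. -/
def IsPValid (P : Measure Ω) (X : ι → Ω → ℝ) (π : Policy ι) : Prop :=
  ∀ s, ¬ Terminal P X s → PValidPortfolio P X s (π s)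

/-- `π` is an instance of the index policy OGP: at a non-terminal state `s` it takes some
arm `i` of `s` with positive mean; if `s` has no arm with negative mean, it selects `i`
with probability one; otherwise it takes some arm `j` of highest mean among the arms
of `s` with negative mean and selects `p_{i,j}`. All choices of `i`, and of `j` among ties,
are allowed. -/
def IsOGP (P : Measure Ω) (X : ι → Ω → ℝ) (π : Policy ι) : Prop :=
  ∀ s, ¬ Terminal P X s → ∃ i ∈ above P X s,
    (neg P X s = ∅ → π s = single i) ∧
    ((neg P X s).Nonempty → ∃ j ∈ neg P X s,
      (∀ k ∈ neg P X s, mean P X k ≤ mean P X j) ∧ π s = mix P X i j)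

/-- `π` is a right-ordered `𝒫`-valid policy, with the order `σ` of the arms with
negative mean: at every non-terminal state that contains such arms, it mixes an arm with positive
mean with the `σ`-minimal one of them. -/
def IsRightOrdered (P : Measure Ω) (X : ι → Ω → ℝ) (π : Policy ι)
    (σ : {a // a ∈ neg P X Finset.univ} ≃ Fin (neg P X Finset.univ).card) : Prop :=
  IsPValid P X π ∧
    ∀ s, ¬ Terminal P X s → (neg P X s).Nonempty →
      ∃ i ∈ above P X s, ∃ j : {a // a ∈ neg P X Finset.univ}, (j : ι) ∈ s ∧
        (∀ k : {a // a ∈ neg P X Finset.univ}, (k : ι) ∈ s → σ j ≤ σ k) ∧ π s = mix P X i j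

/-- The order `σ` lists the arms with negative mean by decreasing mean. -/
def DecreasingMean (P : Measure Ω) (X : ι → Ω → ℝ)
    (σ : {a // a ∈ neg P X Finset.univ} ≃ Fin (neg P X Finset.univ).card) : Prop :=
  ∀ j k, σ j < σ k → mean P X k ≤ mean P X j

end GMDP

end

/-!
OGP amounts to a war of attrition. With `c a = |μ a|`, the portfolio `p_{i,j}` explores `j` with
probability `c i / (c i + c j)` and `i` otherwise. This is the probability that an exponential
lifetime of mean `c j` ends before one of mean `c i`, so that the arms of positive mean and those
of negative mean are two queues whose heads fight, and memorylessness makes the total lifetime of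
the first queue, compared with the partial sums of the second one, the only thing that matters.
The recursion `attrition` computes the value of this game for two lists of arms.

* The order of the first queue is irrelevant (`attrition_perm_left`).
* If the reward `ρ` satisfies the index inequality `IndexLE` for two arms `j`, `k` of the second
  queue, then `j` should come before `k`; moreover the gain from exploring an arm, divided by its
  absolute mean, decreases along a sorted queue (`attrition_exchange`, `attrition_index`).
* The index inequality holds for the terminal reward if `μ k ≤ μ j < 0` (`indexLE_reward`). By
  stochastic order `X j` dominates `X k`; for equal means, dominance in either direction is equality
  in law (`StochDominates.symm_of_integral_eq`). By independence, exploring the dominating arm pays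
  at least as much (`reward_erase_le`), and exploring more arms never hurts (`reward_antitone`).

Let `V s` be the value `ogpValue` of the sorted queues and `j` the best arm of negative mean in `s`.
With `l = (V (s \ j) - V s) / c j ≥ 0`, the recursion gives `V (s \ i) = V s - l * μ i` for *every*
`i` of positive mean, and the index inequality gives `V (s \ k) ≤ V s - l * μ k` for every `k` of
negative mean. Averaging over a portfolio of nonnegative expected reward yields the Bellman
inequality (`sum_mul_ogpValue_erase_le`): `l` is a Lagrange multiplier of the constraint. Hence no
policy, history-dependent or not, does better than `V`, and OGP attains `V`. Right-ordered policies
for decreasing means are instances of OGP (`IsRightOrdered.isOGP`).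
-/

namespace GMDP

/-! ### The attrition recursion -/

section Attrition

variable {ι : Type*} [DecidableEq ι]

/-- The value of a war of attrition between two queues. The heads `i` of `us` and `j` of `ds` are
matched, and `j` is removed with probability `c i / (c i + c j)`, otherwise `i`. The game ends with
payoff `ρ S`, where `S` is the set of the remaining elements of `ds`, when `us` is exhausted, and
with payoff `ρ ∅` when `ds` is exhausted. -/
noncomputable def attrition (c : ι → ℝ) (ρ : Finset ι → ℝ) : List ι → List ι → ℝ
  | [], ds => ρ ds.toFinset
  | _ :: _, [] => ρ ∅
  | i :: us, j :: ds =>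
    (c i * attrition c ρ (i :: us) ds + c j * attrition c ρ us (j :: ds)) / (c i + c j)
termination_by us ds => us.length + ds.length

variable {c : ι → ℝ} {ρ : Finset ι → ℝ}

lemma attrition_nil_left (ds : List ι) : attrition c ρ [] ds = ρ ds.toFinset := by
  rw [attrition]

lemma attrition_nil_right (us : List ι) : attrition c ρ us [] = ρ ∅ := by
  cases us <;> simp [attrition]

lemma attrition_cons_cons (hc : ∀ a, 0 < c a) (i j : ι) (us ds : List ι) :
    (c i + c j) * attrition c ρ (i :: us) (j :: ds) =
      c i * attrition c ρ (i :: us) ds + c j * attrition c ρ us (j :: ds) := by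
  have := hc i
  have := hc j
  rw [attrition.eq_3]
  field_simp

/-- The first identity carries the induction: it is the relation that remains after eliminating the
common successor from the recursions for the two orders. -/
lemma attrition_swap_left_aux (hc : ∀ a, 0 < c a) (i i' : ι) (us ds : List ι) :
    (c i - c i') * attrition c ρ (i :: i' :: us) ds =
        c i * attrition c ρ (i :: us) ds - c i' * attrition c ρ (i' :: us) ds ∧
      attrition c ρ (i :: i' :: us) ds = attrition c ρ (i' :: i :: us) ds := by
  induction ds with
  | nil =>
    simp only [attrition_nil_right]
    exact ⟨by ring, trivial⟩
  | cons j ds ih =>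
    obtain ⟨ih1, ih2⟩ := ih
    have e1 := attrition_cons_cons (ρ := ρ) hc i j (i' :: us) ds
    have e2 := attrition_cons_cons (ρ := ρ) hc i' j (i :: us) ds
    have e3 := attrition_cons_cons (ρ := ρ) hc i j us ds
    have e4 := attrition_cons_cons (ρ := ρ) hc i' j us ds
    rw [← ih2] at e2
    have hi := hc i
    have hi' := hc i'
    have hj := hc j
    have hij : c i + c j ≠ 0 := by positivity
    have hij' : c i' + c j ≠ 0 := by positivity
    refine ⟨mul_left_cancel₀ (mul_ne_zero hij hij') ?_, mul_left_cancel₀ (mul_ne_zero hij hij') ?_⟩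
    · linear_combination (c i' + c j) * (c i - c i') * e1 - c i * (c i' + c j) * e3
        + (c i' * (c i + c j) + c j * (c i - c i')) * e4 + c i * (c i' + c j) * ih1
    · linear_combination (c i' + c j) * e1 - (c i + c j) * e2 + c j * e4 - c j * e3 + c j * ih1

lemma attrition_perm_left (hc : ∀ a, 0 < c a) {us us' : List ι} (h : us.Perm us') (ds : List ι) :
    attrition c ρ us ds = attrition c ρ us' ds := by
  induction h generalizing ds with
  | nil => rfl
  | @cons i us us' _ ih =>
    induction ds with
    | nil => simp only [attrition_nil_right]
    | cons j ds ihd =>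
      have hi := hc i
      have hj := hc j
      have hij : c i + c j ≠ 0 := by positivity
      refine mul_left_cancel₀ hij ?_
      rw [attrition_cons_cons hc, attrition_cons_cons hc, ihd, ih]
  | swap i i' us => exact (attrition_swap_left_aux hc i' i us ds).2
  | trans _ _ ih1 ih2 => rw [ih1, ih2]

/-- The index inequality for `j` and `k`: removing `j` from any set containing both increases `ρ` by
at least as much, relative to the cost `c j`, as removing `k` does relative to `c k`. -/
def IndexLE (c : ι → ℝ) (ρ : Finset ι → ℝ) (j k : ι) : Prop :=
  ∀ S : Finset ι, j ∈ S → k ∈ S → c j * (ρ (S.erase k) - ρ S) ≤ c k * (ρ (S.erase j) - ρ S)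

/-- Both inequalities are carried through the induction on `us` together. With
`D = F (j, k, l) - F (k, j, l)` and
`E = c k * (F (k, l) - F (j, k, l)) - c j * (F (j, l) - F (j, k, l))`, where `D'`, `E'` belong to
the tail of `us` and `i` is its head,
`(c i + c j) * (c i + c k) * D = c i * E' + c k * (c i + c j) * D'` and
`(c i + c j) * E = c j * E'`. -/
lemma attrition_exchange (hc : ∀ a, 0 < c a) {j k : ι} {l : List ι} (hnd : (j :: k :: l).Nodup)
    (hρ : IndexLE c ρ j k) (us : List ι) :
    attrition c ρ us (k :: j :: l) ≤ attrition c ρ us (j :: k :: l) ∧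
      c j * (attrition c ρ us (j :: l) - attrition c ρ us (j :: k :: l)) ≤
        c k * (attrition c ρ us (k :: l) - attrition c ρ us (j :: k :: l)) := by
  induction us with
  | nil =>
    simp only [attrition_nil_left]
    have h := hρ (j :: k :: l).toFinset (by simp) (by simp)
    simp only [List.nodup_cons, List.mem_cons, not_or] at hnd
    have h1 : (j :: k :: l).toFinset.erase k = (j :: l).toFinset := by
      ext a; simp only [Finset.mem_erase, List.mem_toFinset, List.mem_cons]; grind
    have h2 : (j :: k :: l).toFinset.erase j = (k :: l).toFinset := by
      ext a; simp only [Finset.mem_erase, List.mem_toFinset, List.mem_cons]; grind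
    have h3 : (k :: j :: l).toFinset = (j :: k :: l).toFinset := by
      ext a; simp only [List.mem_toFinset, List.mem_cons]; grind
    rw [h1, h2] at h
    exact ⟨by rw [h3], h⟩
  | cons i us ih =>
    obtain ⟨ih1, ih2⟩ := ih
    have e1 := attrition_cons_cons (ρ := ρ) hc i j us (k :: l)
    have e2 := attrition_cons_cons (ρ := ρ) hc i k us l
    have e3 := attrition_cons_cons (ρ := ρ) hc i k us (j :: l)
    have e4 := attrition_cons_cons (ρ := ρ) hc i j us l
    have hi := hc i
    have hj := hc j
    have hk := hc k
    rw [← sub_nonneg] at ih1 ih2 ⊢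
    constructor
    · refine nonneg_of_mul_nonneg_right (a := (c i + c j) * (c i + c k)) ?_ (by positivity)
      have : 0 ≤ c i * (c k * (attrition c ρ us (k :: l) - attrition c ρ us (j :: k :: l)) -
          c j * (attrition c ρ us (j :: l) - attrition c ρ us (j :: k :: l))) +
          c k * (c i + c j) *
            (attrition c ρ us (j :: k :: l) - attrition c ρ us (k :: j :: l)) := by
        positivity
      refine this.trans_eq ?_
      linear_combination -(c i + c k) * e1 - c i * e2 + (c i + c j) * e3 + c i * e4
    · rw [← sub_nonneg]
      refine nonneg_of_mul_nonneg_right (a := c i + c j) ?_ (by positivity)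
      refine (mul_nonneg hj.le ih2).trans_eq ?_
      linear_combination (c k - c j) * e1 - c j * e2 + c j * e4

lemma attrition_cons_mono_right (hc : ∀ a, 0 < c a) {ds ds' : List ι} (hp : ds.Perm ds')
    (h : ∀ us, attrition c ρ us ds ≤ attrition c ρ us ds') (k : ι) (us : List ι) :
    attrition c ρ us (k :: ds) ≤ attrition c ρ us (k :: ds') := by
  induction us with
  | nil =>
    rw [attrition_nil_left, attrition_nil_left, List.toFinset_eq_of_perm _ _ (hp.cons k)]
  | cons i us ih =>
    have hi := hc i
    have hk := hc k
    refine le_of_mul_le_mul_left ?_ (add_pos hi hk)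
    rw [attrition_cons_cons hc, attrition_cons_cons hc]
    have := h (i :: us)
    gcongr

lemma attrition_move_to_front (hc : ∀ a, 0 < c a) {j : ι} {l₁ l₂ : List ι}
    (hnd : (j :: (l₁ ++ l₂)).Nodup) (hj : ∀ k ∈ l₁, IndexLE c ρ j k) (us : List ι) :
    attrition c ρ us (l₁ ++ j :: l₂) ≤ attrition c ρ us (j :: (l₁ ++ l₂)) := by
  induction l₁ generalizing us with
  | nil => simp
  | cons x l₁ ih =>
    have h1 := attrition_cons_mono_right hc (List.perm_middle (a := j) (l₁ := l₁) (l₂ := l₂))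
      (ih (by simp only [List.cons_append, List.nodup_cons, List.mem_cons] at hnd ⊢; tauto)
        fun k hk => hj k (List.mem_cons_of_mem _ hk)) x us
    exact h1.trans (attrition_exchange hc hnd (hj x List.mem_cons_self) us).1

/-- Lists sorted by index maximize the value. -/
lemma attrition_le_of_perm_sorted (hc : ∀ a, 0 < c a) {l l' : List ι}
    (hs : l.Pairwise (IndexLE c ρ)) (hnd : l.Nodup) (hp : l'.Perm l) (us : List ι) :
    attrition c ρ us l' ≤ attrition c ρ us l := by
  induction l generalizing l' us with
  | nil => rw [hp.eq_nil]
  | cons j t ih =>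
    obtain ⟨a, b, rfl⟩ := List.append_of_mem (hp.mem_iff.2 List.mem_cons_self)
    have hp' : (a ++ b).Perm t := (List.perm_middle.symm.trans hp).cons_inv
    rw [List.pairwise_cons] at hs
    have hnd' := List.nodup_cons.1 hnd
    refine (attrition_move_to_front hc ((hp'.cons j).nodup_iff.2 hnd) (fun k hk => hs.1 k ?_)
      us).trans ?_
    · exact hp'.mem_iff.1 (List.mem_append_left _ hk)
    · exact attrition_cons_mono_right hc hp' (fun us => ih hs.2 hnd'.2 hp' us) j us

/-- The gain per unit cost from removing an element of `ds` decreases along `ds`, for two adjacent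
elements. For fixed prefix the recursion is linear, so that the prefix can be peeled off. -/
lemma attrition_index_adjacent (hc : ∀ a, 0 < c a) {j k : ι} {p l : List ι}
    (hnd : (p ++ j :: k :: l).Nodup) (hρ : IndexLE c ρ j k) (us : List ι) :
    c j * (attrition c ρ us (p ++ j :: l) - attrition c ρ us (p ++ j :: k :: l)) ≤
      c k * (attrition c ρ us (p ++ k :: l) - attrition c ρ us (p ++ j :: k :: l)) := by
  induction p generalizing us with
  | nil => exact (attrition_exchange hc hnd hρ us).2
  | cons x p ih =>
    have hnd' : (p ++ j :: k :: l).Nodup := by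
      rw [List.cons_append, List.nodup_cons] at hnd; exact hnd.2
    induction us with
    | nil =>
      simp only [attrition_nil_left]
      have h := hρ (x :: p ++ j :: k :: l).toFinset (by simp) (by simp)
      have h1 : (x :: p ++ j :: k :: l).toFinset.erase k = (x :: p ++ j :: l).toFinset := by
        ext a; simp only [Finset.mem_erase, List.mem_toFinset]; grind
      have h2 : (x :: p ++ j :: k :: l).toFinset.erase j = (x :: p ++ k :: l).toFinset := by
        ext a; simp only [Finset.mem_erase, List.mem_toFinset]; grind
      rwa [h1, h2] at h
    | cons i us ihu =>
      have e1 := attrition_cons_cons (ρ := ρ) hc i x us (p ++ j :: l)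
      have e2 := attrition_cons_cons (ρ := ρ) hc i x us (p ++ k :: l)
      have e3 := attrition_cons_cons (ρ := ρ) hc i x us (p ++ j :: k :: l)
      have hi := hc i
      have hx := hc x
      have h := ih hnd' (i :: us)
      simp only [List.cons_append] at ihu ⊢
      rw [← sub_nonneg] at h ihu ⊢
      refine nonneg_of_mul_nonneg_right (a := c i + c x) ?_ (by positivity)
      refine (add_nonneg (mul_nonneg hi.le h) (mul_nonneg hx.le ihu)).trans_eq ?_
      linear_combination c j * e1 - c k * e2 + (c k - c j) * e3

lemma attrition_index (hc : ∀ a, 0 < c a) {j k : ι} {p m l : List ι}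
    (hnd : (p ++ j :: (m ++ k :: l)).Nodup) (hρ : (j :: (m ++ k :: l)).Pairwise (IndexLE c ρ))
    (us : List ι) :
    c j * (attrition c ρ us (p ++ j :: (m ++ l)) - attrition c ρ us (p ++ j :: (m ++ k :: l))) ≤
      c k * (attrition c ρ us (p ++ (m ++ k :: l)) -
        attrition c ρ us (p ++ j :: (m ++ k :: l))) := by
  induction m generalizing p j with
  | nil =>
    exact attrition_index_adjacent hc hnd ((List.pairwise_cons.1 hρ).1 k (by simp)) us
  | cons x m ih =>
    have h1 := attrition_index_adjacent (l := m ++ k :: l) hc hnd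
      ((List.pairwise_cons.1 hρ).1 x (by simp)) us
    have h2 := ih (p := p ++ [j]) (j := x) (by simpa using hnd) (List.pairwise_cons.1 hρ).2
    simp only [List.append_assoc, List.cons_append, List.nil_append] at h1 h2 ⊢
    have hx := hc x
    have hj := hc j
    have hk := hc k
    -- The chain `gain k / c k ≤ gain x / c x ≤ gain j / c j`, without the denominators.
    refine le_of_mul_le_mul_left ?_ hx
    linarith [mul_le_mul_of_nonneg_left h1 hk.le, mul_le_mul_of_nonneg_left h2 hj.le]

/-- An element in front of the second queue delays the removal of all others. -/
lemma attrition_cons_right_le (hc : ∀ a, 0 < c a) (hρ : ∀ S T : Finset ι, S ⊆ T → ρ T ≤ ρ S)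
    (j : ι) (us ds : List ι) : attrition c ρ us (j :: ds) ≤ attrition c ρ us ds := by
  induction ds generalizing j us with
  | nil =>
    induction us with
    | nil => simp only [attrition_nil_left]; exact hρ _ _ (by simp)
    | cons i us ih =>
      have hi := hc i
      have hj := hc j
      refine le_of_mul_le_mul_left ?_ (add_pos hi hj)
      rw [attrition_cons_cons hc]
      simp only [attrition_nil_right] at ih ⊢
      nlinarith
  | cons d ds ihd =>
    induction us with
    | nil =>
      simp only [attrition_nil_left]
      exact hρ _ _ (by rw [List.toFinset_cons (a := j)]; exact Finset.subset_insert _ _)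
    | cons i us ih =>
      have hi := hc i
      have hj := hc j
      have hd := hc d
      refine le_of_mul_le_mul_left ?_ (add_pos hi hj)
      rw [attrition_cons_cons hc]
      have e := attrition_cons_cons (ρ := ρ) hc i d us ds
      have h1 := ihd d (i :: us)
      -- The value with one more up-element is a mean of two values at least as large.
      have h2 : attrition c ρ us (d :: ds) ≤ attrition c ρ (i :: us) (d :: ds) := by
        refine le_of_mul_le_mul_left ?_ hd
        nlinarith
      nlinarith [mul_le_mul_of_nonneg_left (ih.trans h2) hj.le]

end Attrition

/-! ### First-order stochastic dominance -/

section Dominance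

variable {Ω : Type*} [MeasurableSpace Ω] {P : Measure Ω} [IsProbabilityMeasure P] {Y Z : Ω → ℝ}

lemma StochDominates.measure_upperSet_le (h : StochDominates P Y Z) {T : Set ℝ}
    (hT : IsUpperSet T) : P (Z ⁻¹' T) ≤ P (Y ⁻¹' T) := by
  rcases T.eq_empty_or_nonempty with rfl | hne
  · simp
  by_cases hb : BddBelow T
  · by_cases hmem : sInf T ∈ T
    · have : T = Set.Ici (sInf T) :=
        Set.Subset.antisymm (fun x hx => csInf_le hb hx) fun x hx => hT hx hmem
      rw [this]
      exact h (sInf T)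
    · obtain ⟨u, hu, hu1, hu2⟩ := exists_seq_strictAnti_tendsto (sInf T)
      have hTu : T = ⋃ n, Set.Ici (u n) := by
        ext x
        simp only [Set.mem_iUnion, Set.mem_Ici]
        constructor
        · intro hx
          have : sInf T < x := lt_of_le_of_ne (csInf_le hb hx) fun e => hmem (e ▸ hx)
          obtain ⟨n, hn⟩ := (hu2.eventually (gt_mem_nhds this)).exists
          exact ⟨n, hn.le⟩
        · rintro ⟨n, hn⟩
          obtain ⟨y, hy, hyn⟩ := (csInf_lt_iff hb hne).1 (hu1 n)
          exact hT (hyn.le.trans hn) hy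
      have hm : ∀ W : Ω → ℝ, Monotone fun n => W ⁻¹' Set.Ici (u n) := fun W m n hmn =>
        Set.preimage_mono (Set.Ici_subset_Ici.2 (hu.antitone hmn))
      rw [hTu, Set.preimage_iUnion, Set.preimage_iUnion, (hm Z).measure_iUnion,
        (hm Y).measure_iUnion]
      exact iSup_mono fun n => h (u n)
  · have : T = Set.univ := by
      refine Set.eq_univ_of_forall fun x => ?_
      obtain ⟨y, hy, hyx⟩ := not_bddBelow_iff.1 hb x
      exact hT hyx.le hy
    simp [this]

lemma StochDominates.measure_lowerSet_le (h : StochDominates P Y Z) (hY : Measurable Y)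
    (hZ : Measurable Z) {T : Set ℝ} (hT : IsLowerSet T) : P (Y ⁻¹' T) ≤ P (Z ⁻¹' T) := by
  have hm : MeasurableSet T := hT.ordConnected.measurableSet
  have := h.measure_upperSet_le hT.compl
  rw [Set.preimage_compl, Set.preimage_compl, prob_compl_eq_one_sub (hZ hm),
    prob_compl_eq_one_sub (hY hm)] at this
  exact (ENNReal.sub_le_sub_iff_left prob_le_one ENNReal.one_ne_top).1 this

lemma StochDominates.lintegral_le (h : StochDominates P Y Z) (hY : Measurable Y)
    (hZ : Measurable Z) {f : ℝ → ℝ} (hf : Monotone f) (h0 : ∀ x, 0 ≤ f x) :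
    ∫⁻ ω, ENNReal.ofReal (f (Z ω)) ∂P ≤ ∫⁻ ω, ENNReal.ofReal (f (Y ω)) ∂P := by
  rw [lintegral_eq_lintegral_meas_le P (Filter.Eventually.of_forall fun ω => h0 _)
      (hf.measurable.comp hZ).aemeasurable,
    lintegral_eq_lintegral_meas_le P (Filter.Eventually.of_forall fun ω => h0 _)
      (hf.measurable.comp hY).aemeasurable]
  refine lintegral_mono fun t => ?_
  exact h.measure_upperSet_le (T := {x | t ≤ f x}) fun x y hxy hx => le_trans hx (hf hxy)

lemma StochDominates.lintegral_le_of_antitone (h : StochDominates P Y Z) (hY : Measurable Y)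
    (hZ : Measurable Z) {f : ℝ → ℝ} (hf : Antitone f) (h0 : ∀ x, 0 ≤ f x) :
    ∫⁻ ω, ENNReal.ofReal (f (Y ω)) ∂P ≤ ∫⁻ ω, ENNReal.ofReal (f (Z ω)) ∂P := by
  rw [lintegral_eq_lintegral_meas_le P (Filter.Eventually.of_forall fun ω => h0 _)
      (hf.measurable.comp hZ).aemeasurable,
    lintegral_eq_lintegral_meas_le P (Filter.Eventually.of_forall fun ω => h0 _)
      (hf.measurable.comp hY).aemeasurable]
  refine lintegral_mono fun t => ?_
  exact h.measure_lowerSet_le hY hZ (T := {x | t ≤ f x}) fun x y hxy hx => le_trans hx (hf hxy)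

lemma StochDominates.integral_le (h : StochDominates P Y Z) (hY : Measurable Y)
    (hZ : Measurable Z) {f : ℝ → ℝ} (hf : Monotone f) (hfY : Integrable (fun ω => f (Y ω)) P)
    (hfZ : Integrable (fun ω => f (Z ω)) P) : ∫ ω, f (Z ω) ∂P ≤ ∫ ω, f (Y ω) ∂P := by
  rw [integral_eq_lintegral_pos_part_sub_lintegral_neg_part hfY,
    integral_eq_lintegral_pos_part_sub_lintegral_neg_part hfZ]
  have h1 := h.lintegral_le hY hZ (f := fun x => max (f x) 0)
    (fun x y hxy => max_le_max_right 0 (hf hxy)) fun x => le_max_right _ _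
  have h2 := h.lintegral_le_of_antitone hY hZ (f := fun x => max (-f x) 0)
    (fun x y hxy => max_le_max_right 0 (neg_le_neg (hf hxy))) fun x => le_max_right _ _
  have e : ∀ x : ℝ, ENNReal.ofReal (max x 0) = ENNReal.ofReal x := fun x => by
    rw [ENNReal.ofReal_max]; simp
  simp only [e] at h1 h2
  have t1 := hfY.lintegral_lt_top.ne
  have t2 := hfZ.neg.lintegral_lt_top.ne
  exact sub_le_sub (ENNReal.toReal_mono t1 h1) (ENNReal.toReal_mono t2 h2)

/-- Dominance between variables of equal mean forces equality in law. For nondecreasing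
`1`-Lipschitz `f`, both `f` and `id - f` are monotone, so that `f (Y)` and `f (Z)` have the same
mean; a steep ramp from `0` to `1` compares the survival functions. -/
lemma StochDominates.symm_of_integral_eq (h : StochDominates P Y Z) (hY : Measurable Y)
    (hZ : Measurable Z) (hYi : Integrable Y P) (hZi : Integrable Z P)
    (he : ∫ ω, Y ω ∂P = ∫ ω, Z ω ∂P) : StochDominates P Z Y := by
  intro x
  have key : ∀ ε : ℝ, 0 < ε → P {ω | x ≤ Y ω} ≤ P {ω | x - ε ≤ Z ω} := by
    intro ε hε
    set f : ℝ → ℝ := fun y => max 0 (min ε (y - (x - ε))) with hf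
    have hfm : Monotone f := fun a b hab => by simp only [hf]; gcongr
    have hgm : Monotone fun y => y - f y := fun a b hab => by
      simp only [hf]
      rcases max_cases 0 (min ε (a - (x - ε))) with h1 | h1 <;>
      rcases max_cases 0 (min ε (b - (x - ε))) with h2 | h2 <;>
      rcases min_cases ε (a - (x - ε)) with h3 | h3 <;>
      rcases min_cases ε (b - (x - ε)) with h4 | h4 <;> linarith
    have hint : ∀ W : Ω → ℝ, Measurable W → Integrable (fun ω => f (W ω)) P := fun W hW => by
      refine Integrable.of_bound (hfm.measurable.comp hW).aestronglyMeasurable ε ?_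
      refine Filter.Eventually.of_forall fun ω => ?_
      rw [Real.norm_of_nonneg (le_max_left _ _)]
      exact max_le hε.le (min_le_left _ _)
    have h2 := h.integral_le hY hZ hgm (hYi.sub (hint Y hY)) (hZi.sub (hint Z hZ))
    rw [integral_sub hYi (hint Y hY), integral_sub hZi (hint Z hZ), he] at h2
    have h3 : ε * P.real {ω | x ≤ Y ω} ≤ ∫ ω, f (Y ω) ∂P := by
      have hms : MeasurableSet {ω | x ≤ Y ω} := measurableSet_le measurable_const hY
      rw [mul_comm, ← smul_eq_mul, ← integral_indicator_const ε hms]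
      refine integral_mono ((integrable_const ε).indicator hms) (hint Y hY) fun ω => ?_
      by_cases hω : x ≤ Y ω
      · rw [Set.indicator_of_mem (by exact hω)]
        exact le_max_of_le_right (le_min le_rfl (by linarith))
      · rw [Set.indicator_of_notMem (by exact hω)]
        exact le_max_left _ _
    have h4 : ∫ ω, f (Z ω) ∂P ≤ ε * P.real {ω | x - ε ≤ Z ω} := by
      have hms : MeasurableSet {ω | x - ε ≤ Z ω} := measurableSet_le measurable_const hZ
      rw [mul_comm, ← smul_eq_mul, ← integral_indicator_const ε hms]
      refine integral_mono (hint Z hZ) ((integrable_const ε).indicator hms) fun ω => ?_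
      by_cases hω : x - ε ≤ Z ω
      · rw [Set.indicator_of_mem (by exact hω)]
        exact max_le hε.le (min_le_left _ _)
      · rw [Set.indicator_of_notMem (by exact hω)]
        exact max_le le_rfl (min_le_of_right_le (by linarith))
    have h5 : P.real {ω | x ≤ Y ω} ≤ P.real {ω | x - ε ≤ Z ω} :=
      le_of_mul_le_mul_left (by linarith) hε
    exact (ENNReal.toReal_le_toReal (measure_ne_top _ _) (measure_ne_top _ _)).1 h5
  obtain ⟨u, hu, hu1, hu2⟩ := exists_seq_strictAnti_tendsto (0 : ℝ)
  have hInter : {ω | x ≤ Z ω} = ⋂ n, {ω | x - u n ≤ Z ω} := by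
    ext ω
    simp only [Set.mem_iInter, Set.mem_ofPred_eq]
    refine ⟨fun hω n => by linarith [hu1 n], fun hω => ?_⟩
    have : Filter.Tendsto (fun n => x - u n) Filter.atTop (nhds (x - 0)) := hu2.const_sub x
    rw [sub_zero] at this
    exact le_of_tendsto' this hω
  have hanti : Antitone fun n => {ω | x - u n ≤ Z ω} := fun m n hmn ω hω => by
    have := hu.antitone hmn
    simp only [Set.mem_ofPred_eq] at hω ⊢
    linarith
  rw [hInter, hanti.measure_iInter
    (fun n => (measurableSet_le measurable_const hZ).nullMeasurableSet) ⟨0, measure_ne_top _ _⟩]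
  exact le_iInf fun n => key (u n) (hu1 n)

/-- Replacing a variable by a dominating one, in the presence of an independent variable. -/
lemma StochDominates.lintegral_le_of_indepFun (h : StochDominates P Y Z) (hY : Measurable Y)
    (hZ : Measurable Z) {E : Type*} [MeasurableSpace E] {V : Ω → E} (hV : Measurable V)
    (hVY : IndepFun V Y P) (hVZ : IndepFun V Z P) {f : E → ℝ → ℝ}
    (hfm : Measurable (Function.uncurry f)) (hf : ∀ v, Monotone (f v)) (h0 : ∀ v x, 0 ≤ f v x) :
    ∫⁻ ω, ENNReal.ofReal (f (V ω) (Z ω)) ∂P ≤ ∫⁻ ω, ENNReal.ofReal (f (V ω) (Y ω)) ∂P := by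
  have key : ∀ W : Ω → ℝ, Measurable W → IndepFun V W P →
      ∫⁻ ω, ENNReal.ofReal (f (V ω) (W ω)) ∂P =
        ∫⁻ v, ∫⁻ ω, ENNReal.ofReal (f v (W ω)) ∂P ∂(P.map V) := by
    intro W hW hVW
    have hg : Measurable fun p : E × ℝ => ENNReal.ofReal (f p.1 p.2) := hfm.ennreal_ofReal
    have := Measure.isProbabilityMeasure_map hV.aemeasurable (μ := P)
    have := Measure.isProbabilityMeasure_map hW.aemeasurable (μ := P)
    rw [← lintegral_map (f := fun p : E × ℝ => ENNReal.ofReal (f p.1 p.2))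
      (g := fun ω => (V ω, W ω)) hg (hV.prodMk hW),
      hVW.map_prod_eq_prod_map_map hV.aemeasurable hW.aemeasurable,
      lintegral_prod _ hg.aemeasurable]
    refine lintegral_congr fun v => ?_
    exact lintegral_map (hg.comp measurable_prodMk_left) hW
  rw [key Z hZ hVZ, key Y hY hVY]
  exact lintegral_mono fun v => h.lintegral_le hY hZ (hf v) (h0 v)

end Dominance

/-! ### Rewards of terminal states -/

section Reward

variable {ι Ω : Type*}

/-- The reward gained by exploring an arm of realized reward `x` in addition to the arms outside
`s`: it vanishes if `x ≤ 0`, or if one of the latter arms is positive, since then `x` is not needed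
to collect the maximum. Here `v` holds the realized rewards of the arms in `T`, meant to be all
arms except this one and one arm of nonpositive reward, which cannot attain the maximum. For empty
`T` the supremum is `0`, which is harmless because `0 < x`. -/
noncomputable def soleReward (s T : Finset ι) (v : T → ℝ) (x : ℝ) : ℝ :=
  open Classical in
  if (∀ a : T, (a : ι) ∉ s → v a ≤ 0) ∧ 0 < x then max x (⨆ a, v a) else 0

lemma soleReward_nonneg (s T : Finset ι) (v : T → ℝ) (x : ℝ) : 0 ≤ soleReward s T v x := by
  rw [soleReward]
  split_ifs with h
  · exact h.2.le.trans (le_max_left _ _)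
  · exact le_rfl

lemma soleReward_monotone (s T : Finset ι) (v : T → ℝ) : Monotone (soleReward s T v) := by
  intro x y hxy
  by_cases h : (∀ a : T, (a : ι) ∉ s → v a ≤ 0) ∧ 0 < x
  · rw [soleReward, soleReward, if_pos h, if_pos ⟨h.1, h.2.trans_le hxy⟩]
    exact max_le_max_right _ hxy
  · rw [soleReward, if_neg h]
    exact soleReward_nonneg s T v y

lemma measurable_soleReward (s T : Finset ι) :
    Measurable (Function.uncurry (soleReward s T)) := by
  refine Measurable.ite ?_ (measurable_snd.max (Measurable.iSup fun a => by fun_prop))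
    measurable_const
  refine MeasurableSet.inter ?_ (measurableSet_lt measurable_const measurable_snd)
  change MeasurableSet {p : (T → ℝ) × ℝ | ∀ a : T, (a : ι) ∉ s → p.1 a ≤ 0}
  simp only [Set.ofPred_forall]
  exact MeasurableSet.iInter fun a => MeasurableSet.iInter fun _ =>
    measurableSet_le (by fun_prop) measurable_const

variable [Fintype ι] {X : ι → Ω → ℝ}

lemma le_iSup_reward (a : ι) (ω : Ω) : X a ω ≤ ⨆ b, X b ω :=
  le_ciSup (f := fun b => X b ω) (Set.finite_range _).bddAbove a

variable [DecidableEq ι]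

lemma realizedReward_eq_iSup {s : Finset ι} {ω : Ω} {a : ι} (ha : a ∉ s) (h : 0 < X a ω) :
    realizedReward X s ω = ⨆ b, X b ω := by
  rw [realizedReward, if_pos ⟨a, ha, h⟩]

lemma realizedReward_eq_zero {s : Finset ι} {ω : Ω} (h : ∀ a, a ∉ s → X a ω ≤ 0) :
    realizedReward X s ω = 0 := by
  rw [realizedReward, if_neg]
  rintro ⟨a, ha, h'⟩
  exact absurd h' (h a ha).not_gt

lemma realizedReward_nonneg (s : Finset ι) (ω : Ω) : 0 ≤ realizedReward X s ω := by
  rw [realizedReward]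
  split_ifs with h
  · obtain ⟨a, _, ha⟩ := h
    exact ha.le.trans (le_iSup_reward a ω)
  · exact le_rfl

lemma realizedReward_antitone {s t : Finset ι} (hst : s ⊆ t) (ω : Ω) :
    realizedReward X t ω ≤ realizedReward X s ω := by
  by_cases h : ∃ a, a ∉ t ∧ 0 < X a ω
  · obtain ⟨a, ha, h⟩ := h
    rw [realizedReward_eq_iSup ha h, realizedReward_eq_iSup (fun h' => ha (hst h')) h]
  · push Not at h
    rw [realizedReward_eq_zero h]
    exact realizedReward_nonneg s ω

open Classical in
/-- The part of the realized reward at `s.erase j` that is symmetric in `j` and `k`: it leaves out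
the outcomes in which `j` is the only positive one among `j`, `k` and the arms outside `s`. -/
noncomputable def commonReward (X : ι → Ω → ℝ) (s : Finset ι) (j k : ι) (ω : Ω) : ℝ :=
  if 0 < X j ω ∧ 0 < X k ω then ⨆ a, X a ω else realizedReward X s ω

lemma commonReward_comm (s : Finset ι) (j k : ι) :
    commonReward X s j k = commonReward X s k j := by
  ext ω
  simp only [commonReward, and_comm]

lemma commonReward_nonneg (s : Finset ι) (j k : ι) (ω : Ω) : 0 ≤ commonReward X s j k ω := by
  rw [commonReward]
  split_ifs with h
  · exact h.1.le.trans (le_iSup_reward j ω)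
  · exact realizedReward_nonneg s ω

/-- Only the last term, a product of functions of disjoint sets of arms, changes when `j` and `k`
are exchanged. -/
lemma realizedReward_erase {s T : Finset ι} {j k : ι} (hj : j ∈ s) (hk : k ∈ s)
    (hT : ∀ a, a ∈ T ↔ a ≠ j ∧ a ≠ k) (ω : Ω) :
    realizedReward X (s.erase j) ω = commonReward X s j k ω +
      soleReward s T (fun a => X a ω) (X j ω) * (if X k ω ≤ 0 then 1 else 0) := by
  have hjs : j ∉ s.erase j := by simp
  by_cases h : ∃ a, a ∉ s ∧ 0 < X a ω
  · obtain ⟨a, ha, h⟩ := h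
    have haT : a ∈ T := (hT a).2 ⟨fun e => ha (e ▸ hj), fun e => ha (e ▸ hk)⟩
    have h0 : soleReward s T (fun a => X a ω) (X j ω) = 0 := by
      rw [soleReward, if_neg]
      exact fun h' => absurd h (h'.1 ⟨a, haT⟩ ha).not_gt
    rw [h0, zero_mul, add_zero, commonReward, realizedReward_eq_iSup ha h, ite_self,
      realizedReward_eq_iSup (fun h' => ha (Finset.mem_of_mem_erase h')) h]
  · push Not at h
    have hN : ∀ a : T, (a : ι) ∉ s → X a ω ≤ 0 := fun a => h a
    by_cases hxj : 0 < X j ω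
    · rw [realizedReward_eq_iSup hjs hxj]
      by_cases hxk : 0 < X k ω
      · rw [commonReward, if_pos ⟨hxj, hxk⟩, if_neg hxk.not_ge, mul_zero, add_zero]
      · rw [commonReward, if_neg (fun h' => hxk h'.2), if_pos (not_lt.1 hxk), mul_one,
          realizedReward_eq_zero h, zero_add, soleReward, if_pos ⟨hN, hxj⟩]
        have : Nonempty ι := ⟨j⟩
        refine le_antisymm (ciSup_le fun b => ?_) (max_le (le_iSup_reward j ω) ?_)
        · by_cases hb : b ∈ T
          · exact le_max_of_le_right
              (le_ciSup (f := fun a : T => X a ω) (Set.finite_range _).bddAbove ⟨b, hb⟩)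
          · refine le_max_of_le_left ?_
            rw [hT, not_and_or, not_ne_iff, not_ne_iff] at hb
            rcases hb with rfl | rfl
            · exact le_rfl
            · exact (not_lt.1 hxk).trans hxj.le
        · exact Real.iSup_le (fun a => le_iSup_reward (a : ι) ω)
            (hxj.le.trans (le_iSup_reward j ω))
    · rw [commonReward, if_neg (fun h' => hxj h'.1), realizedReward_eq_zero h, soleReward,
        if_neg (fun h' => hxj h'.2), zero_mul, add_zero, realizedReward_eq_zero]
      intro a ha
      rcases eq_or_ne a j with rfl | haj
      · exact not_lt.1 hxj
      · exact h a fun has => ha (Finset.mem_erase.2 ⟨haj, has⟩)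

variable [MeasurableSpace Ω] {P : Measure Ω}

lemma measurable_realizedReward (hX : ∀ a, Measurable (X a)) (s : Finset ι) :
    Measurable (realizedReward X s) := by
  refine Measurable.ite ?_ (Measurable.iSup hX) measurable_const
  simp only [Set.ofPred_exists, Set.ofPred_and]
  exact MeasurableSet.iUnion fun a =>
    (MeasurableSet.const _).inter (measurableSet_lt measurable_const (hX a))

lemma integrable_realizedReward (hX : ∀ a, Measurable (X a)) (hint : ∀ a, Integrable (X a) P)
    (s : Finset ι) : Integrable (realizedReward X s) P := by
  refine Integrable.mono' (integrable_finsetSum Finset.univ fun a _ => (hint a).abs)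
    (measurable_realizedReward hX s).aestronglyMeasurable (Filter.Eventually.of_forall fun ω => ?_)
  rw [Real.norm_of_nonneg (realizedReward_nonneg s ω), realizedReward]
  have h0 : 0 ≤ ∑ a, |X a ω| := Finset.sum_nonneg fun a _ => abs_nonneg _
  split_ifs with h
  · obtain ⟨a, _⟩ := h
    have : Nonempty ι := ⟨a⟩
    exact ciSup_le fun b => (le_abs_self _).trans
      (Finset.single_le_sum (f := fun a => |X a ω|) (fun a _ => abs_nonneg _) (Finset.mem_univ b))
  · exact h0

lemma reward_antitone (hX : ∀ a, Measurable (X a)) (hint : ∀ a, Integrable (X a) P)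
    {s t : Finset ι} (hst : s ⊆ t) : reward P X t ≤ reward P X s :=
  integral_mono (integrable_realizedReward hX hint t) (integrable_realizedReward hX hint s)
    fun ω => realizedReward_antitone hst ω

lemma measurable_commonReward (hX : ∀ a, Measurable (X a)) (s : Finset ι) (j k : ι) :
    Measurable (commonReward X s j k) :=
  Measurable.ite ((measurableSet_lt measurable_const (hX j)).inter
    (measurableSet_lt measurable_const (hX k))) (Measurable.iSup hX)
    (measurable_realizedReward hX s)

lemma lintegral_realizedReward_erase (hX : ∀ a, Measurable (X a)) (hindep : iIndepFun X P)
    {s T : Finset ι} {j k : ι} (hj : j ∈ s) (hk : k ∈ s) (hjk : j ≠ k)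
    (hT : ∀ a, a ∈ T ↔ a ≠ j ∧ a ≠ k) :
    ∫⁻ ω, ENNReal.ofReal (realizedReward X (s.erase j) ω) ∂P =
      ∫⁻ ω, ENNReal.ofReal (commonReward X s j k ω) ∂P +
      (∫⁻ ω, ENNReal.ofReal (soleReward s T (fun a => X a ω) (X j ω)) ∂P) * P {ω | X k ω ≤ 0} := by
  have hms : MeasurableSet {ω | X k ω ≤ 0} := measurableSet_le (hX k) measurable_const
  have hsm : Measurable fun ω => ENNReal.ofReal (soleReward s T (fun a => X a ω) (X j ω)) :=
    ((measurable_soleReward s T).comp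
      ((measurable_pi_lambda _ fun a : T => hX a).prodMk (hX j))).ennreal_ofReal
  have hind : IndepFun (fun ω => ENNReal.ofReal (soleReward s T (fun a => X a ω) (X j ω)))
      (fun ω => (Set.Iic (0 : ℝ)).indicator (1 : ℝ → ENNReal) (X k ω)) P := by
    have h := hindep.indepFun_finset (insert j T) {k} (by simp [hT, hjk.symm]) hX
    have hφ : Measurable fun v : ↥(insert j T) → ℝ => ENNReal.ofReal (soleReward s T
        (fun a => v ⟨a, Finset.mem_insert_of_mem a.2⟩) (v ⟨j, Finset.mem_insert_self j T⟩)) :=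
      ((measurable_soleReward s T).comp
        (f := fun v : ↥(insert j T) → ℝ => ((fun a : T => v ⟨a, Finset.mem_insert_of_mem a.2⟩),
          v ⟨j, Finset.mem_insert_self j T⟩)) (by fun_prop)).ennreal_ofReal
    have hψ : Measurable fun v : ↥({k} : Finset ι) → ℝ =>
        (Set.Iic (0 : ℝ)).indicator (1 : ℝ → ENNReal) (v ⟨k, Finset.mem_singleton_self k⟩) :=
      (measurable_one.indicator measurableSet_Iic).comp (measurable_pi_apply _)
    exact h.comp hφ hψ
  have hprod := lintegral_mul_eq_lintegral_mul_lintegral_of_indepFun hsm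
    ((measurable_one.indicator measurableSet_Iic).comp (hX k)) hind
  have hone : ∫⁻ ω, (Set.Iic (0 : ℝ)).indicator (1 : ℝ → ENNReal) (X k ω) ∂P =
      P {ω | X k ω ≤ 0} := by
    rw [← lintegral_indicator_one hms]
    rfl
  rw [← hone]
  refine Eq.trans ?_ (congrArg _ hprod)
  rw [← lintegral_add_left (measurable_commonReward hX s j k).ennreal_ofReal]
  refine lintegral_congr fun ω => ?_
  rw [realizedReward_erase hj hk hT ω, ENNReal.ofReal_add (commonReward_nonneg s j k ω)
    (mul_nonneg (soleReward_nonneg _ _ _ _) (by split_ifs <;> norm_num)),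
    ENNReal.ofReal_mul (soleReward_nonneg _ _ _ _)]
  congr 2
  by_cases h : X k ω ≤ 0 <;> simp [h]

/-- Exploring the dominating one of two arms is at least as good. -/
lemma reward_erase_le [IsProbabilityMeasure P] (hX : ∀ a, Measurable (X a))
    (hint : ∀ a, Integrable (X a) P) (hindep : iIndepFun X P) {s : Finset ι} {j k : ι}
    (hj : j ∈ s) (hk : k ∈ s) (h : StochDominates P (X j) (X k)) :
    reward P X (s.erase k) ≤ reward P X (s.erase j) := by
  rcases eq_or_ne j k with rfl | hjk
  · exact le_rfl
  have hint' := fun a => integrable_realizedReward (P := P) hX hint (s.erase a)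
  rw [reward, reward,
    integral_eq_lintegral_of_nonneg_ae (Filter.Eventually.of_forall (realizedReward_nonneg _))
      (hint' k).aestronglyMeasurable,
    integral_eq_lintegral_of_nonneg_ae (Filter.Eventually.of_forall (realizedReward_nonneg _))
      (hint' j).aestronglyMeasurable]
  refine ENNReal.toReal_mono (hint' j).lintegral_lt_top.ne ?_
  set T : Finset ι := {j, k}ᶜ with hTdef
  have hT : ∀ a, a ∈ T ↔ a ≠ j ∧ a ≠ k := fun a => by simp [hTdef]
  have hT' : ∀ a, a ∈ T ↔ a ≠ k ∧ a ≠ j := fun a => by rw [hT, and_comm]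
  rw [lintegral_realizedReward_erase hX hindep hj hk hjk hT,
    lintegral_realizedReward_erase hX hindep hk hj hjk.symm hT', commonReward_comm s k j]
  have hV : Measurable fun ω => fun a : T => X a ω := measurable_pi_lambda _ fun a => hX a
  have hVind : ∀ b, b ∉ T → IndepFun (fun ω => fun a : T => X a ω) (X b) P := fun b hb => by
    have := hindep.indepFun_finset T {b} (by simpa using hb) hX
    exact this.comp measurable_id (measurable_pi_apply (⟨b, by simp⟩ : ({b} : Finset ι)))
  gcongr ?_ + ?_ * ?_
  · exact le_rfl
  · exact h.lintegral_le_of_indepFun (hX j) (hX k) hV (hVind j (by simp [hT]))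
      (hVind k (by simp [hT])) (measurable_soleReward s T) (soleReward_monotone s T)
      (soleReward_nonneg s T)
  · exact h.measure_lowerSet_le (hX j) (hX k) (T := Set.Iic 0) (isLowerSet_Iic 0)

end Reward

/-! ### The optimal value -/

section Value

variable {ι Ω : Type*} [MeasurableSpace Ω] {P : Measure Ω} {X : ι → Ω → ℝ}

/-- The absolute mean of an arm. -/
noncomputable def absMean (P : Measure Ω) (X : ι → Ω → ℝ) (a : ι) : ℝ := |mean P X a|

lemma absMean_pos (hne : ∀ a, mean P X a ≠ 0) (a : ι) : 0 < absMean P X a := abs_pos.2 (hne a)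

lemma mem_above {s : Finset ι} {a : ι} : a ∈ above P X s ↔ a ∈ s ∧ 0 < mean P X a := by
  simp [above]

lemma mem_neg {s : Finset ι} {a : ι} : a ∈ neg P X s ↔ a ∈ s ∧ mean P X a < 0 := by
  simp [neg]

lemma absMean_of_mem_above {s : Finset ι} {a : ι} (h : a ∈ above P X s) :
    absMean P X a = mean P X a := abs_of_pos (mem_above.1 h).2

lemma absMean_of_mem_neg {s : Finset ι} {a : ι} (h : a ∈ neg P X s) :
    absMean P X a = -mean P X a := abs_of_neg (mem_neg.1 h).2

/-- `ds` lists the arms of `s` with negative mean in order of decreasing mean. -/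
def IsNegSorting (P : Measure Ω) (X : ι → Ω → ℝ) (s : Finset ι) (ds : List ι) : Prop :=
  ds.Perm (neg P X s).toList ∧ ds.Pairwise fun a b => mean P X b ≤ mean P X a

lemma exists_isNegSorting (s : Finset ι) : ∃ ds, IsNegSorting P X s ds := by
  classical
  have : Std.Total fun a b : ι => mean P X b ≤ mean P X a := ⟨fun a b => le_total _ _⟩
  have : IsTrans ι fun a b => mean P X b ≤ mean P X a := ⟨fun _ _ _ h h' => h'.trans h⟩
  exact ⟨(neg P X s).toList.insertionSort fun a b => mean P X b ≤ mean P X a,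
    List.perm_insertionSort _ _, List.pairwise_insertionSort _ _⟩

namespace IsNegSorting

variable {s : Finset ι} {ds : List ι}

lemma mem_iff (h : IsNegSorting P X s ds) {a : ι} : a ∈ ds ↔ a ∈ neg P X s := by
  rw [h.1.mem_iff, Finset.mem_toList]

lemma nodup (h : IsNegSorting P X s ds) : ds.Nodup := h.1.nodup_iff.2 (Finset.nodup_toList _)

lemma of_mem_iff (hnd : ds.Nodup) (hs : ds.Pairwise fun a b => mean P X b ≤ mean P X a)
    (h : ∀ a, a ∈ ds ↔ a ∈ neg P X s) : IsNegSorting P X s ds :=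
  ⟨(List.perm_ext_iff_of_nodup hnd (Finset.nodup_toList _)).2 (by simpa using h), hs⟩

variable [DecidableEq ι]

lemma erase_above (h : IsNegSorting P X s ds) {i : ι} (hi : i ∈ above P X s) :
    IsNegSorting P X (s.erase i) ds := by
  refine of_mem_iff h.nodup h.2 fun a => ?_
  rw [h.mem_iff, mem_neg, mem_neg, Finset.mem_erase]
  have := (mem_above.1 hi).2
  exact ⟨fun ha => ⟨⟨fun e => by subst e; linarith [ha.2], ha.1⟩, ha.2⟩, fun ha => ⟨ha.1.2, ha.2⟩⟩

lemma of_append_cons {k : ι} {l₁ l₂ : List ι} (h : IsNegSorting P X s (l₁ ++ k :: l₂)) :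
    IsNegSorting P X (s.erase k) (l₁ ++ l₂) := by
  have hsub : (l₁ ++ l₂).Sublist (l₁ ++ k :: l₂) :=
    List.Sublist.append_left (List.sublist_cons_self _ _) _
  have hnd := List.nodup_middle.1 h.nodup
  refine of_mem_iff (h.nodup.sublist hsub) (h.2.sublist hsub) fun a => ?_
  have hk := (List.nodup_cons.1 hnd).1
  have ha := h.mem_iff (a := a)
  rw [mem_neg] at ha ⊢
  rw [Finset.mem_erase, and_assoc, ← ha]
  simp only [List.mem_append, List.mem_cons] at hk ⊢
  grind

lemma exists_cons {j : ι} (hj : j ∈ neg P X s) (hmax : ∀ k ∈ neg P X s, mean P X k ≤ mean P X j) :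
    ∃ ds, IsNegSorting P X s (j :: ds) := by
  obtain ⟨ds, hds⟩ := exists_isNegSorting (P := P) (X := X) (s.erase j)
  have hmem : ∀ a, a ∈ ds ↔ a ≠ j ∧ a ∈ neg P X s := fun a => by
    rw [hds.mem_iff, mem_neg, mem_neg, Finset.mem_erase, and_assoc]
  refine ⟨ds, of_mem_iff (List.nodup_cons.2 ⟨fun h => ((hmem j).1 h).1 rfl, hds.nodup⟩)
    (List.pairwise_cons.2 ⟨fun a ha => hmax a ((hmem a).1 ha).2, hds.2⟩) fun a => ?_⟩
  rw [List.mem_cons, hmem]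
  constructor
  · rintro (rfl | h)
    exacts [hj, h.2]
  · intro h
    by_cases e : a = j
    exacts [Or.inl e, Or.inr ⟨e, h⟩]

end IsNegSorting

section

variable [DecidableEq ι] {s : Finset ι}

lemma cons_perm_above {i : ι} (hi : i ∈ above P X s) :
    (i :: (above P X (s.erase i)).toList).Perm (above P X s).toList := by
  have h : i ∉ above P X (s.erase i) := by simp [mem_above]
  refine (Finset.toList_insert h).symm.trans ?_
  have : insert i (above P X (s.erase i)) = above P X s := by
    ext a
    rw [Finset.mem_insert, mem_above, mem_above, Finset.mem_erase]
    rw [mem_above] at hi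
    constructor
    · rintro (rfl | h)
      exacts [hi, ⟨h.1.2, h.2⟩]
    · intro h
      by_cases e : a = i
      exacts [Or.inl e, Or.inr ⟨⟨e, h.1⟩, h.2⟩]
  rw [this]

lemma above_erase_of_mem_neg {j : ι} (hj : j ∈ neg P X s) :
    above P X (s.erase j) = above P X s := by
  ext a
  rw [mem_above, mem_above, Finset.mem_erase]
  have := (mem_neg.1 hj).2
  exact ⟨fun ha => ⟨ha.1.2, ha.2⟩, fun ha => ⟨⟨fun e => by subst e; linarith [ha.2], ha.1⟩, ha.2⟩⟩

end

section

variable [Fintype ι]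

/-- Among arms of negative mean, one of larger mean dominates. If the hypothesis provides the
reverse dominance, the means are equal, and then so are the laws. -/
lemma NegStochOrdered.stochDominates [IsProbabilityMeasure P] (hX : ∀ a, Measurable (X a))
    (hint : ∀ a, Integrable (X a) P) (hord : NegStochOrdered P X) {j k : ι}
    (hj : mean P X j < 0) (hk : mean P X k < 0) (hjk : mean P X k ≤ mean P X j) :
    StochDominates P (X j) (X k) := by
  rcases hord j (mem_neg.2 ⟨Finset.mem_univ _, hj⟩) k (mem_neg.2 ⟨Finset.mem_univ _, hk⟩)
    with h | h
  · exact h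
  · have := h.integral_le (hX k) (hX j) monotone_id (hint k) (hint j)
    exact h.symm_of_integral_eq (hX k) (hX j) (hint k) (hint j) (le_antisymm hjk this)

lemma indexLE_reward [DecidableEq ι] [IsProbabilityMeasure P] (hX : ∀ a, Measurable (X a))
    (hint : ∀ a, Integrable (X a) P) (hindep : iIndepFun X P) (hord : NegStochOrdered P X)
    {j k : ι} (hj : mean P X j < 0) (hk : mean P X k < 0) (hjk : mean P X k ≤ mean P X j) :
    IndexLE (absMean P X) (reward P X) j k := by
  intro S hjS hkS
  have h1 := reward_erase_le hX hint hindep hjS hkS (hord.stochDominates hX hint hj hk hjk)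
  have h2 := reward_antitone (P := P) hX hint (Finset.erase_subset k S)
  rw [absMean, absMean, abs_of_neg hj, abs_of_neg hk]
  exact mul_le_mul (by linarith) (by linarith) (by linarith) (by linarith)

lemma IsNegSorting.pairwise_indexLE [DecidableEq ι] [IsProbabilityMeasure P]
    (hX : ∀ a, Measurable (X a)) (hint : ∀ a, Integrable (X a) P)
    (hindep : iIndepFun X P) (hord : NegStochOrdered P X) {s : Finset ι} {ds : List ι}
    (h : IsNegSorting P X s ds) : ds.Pairwise (IndexLE (absMean P X) (reward P X)) :=
  h.2.imp_of_mem fun ha hb hab => indexLE_reward hX hint hindep hord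
    (mem_neg.1 (h.mem_iff.1 ha)).2 (mem_neg.1 (h.mem_iff.1 hb)).2 hab

lemma sum_eq_one_of_mem_MIR {s : Finset ι} {p : ι → ℝ} (hp : p ∈ MIR P X s) :
    ∑ a ∈ s, p a = 1 := by
  rw [← hp.1.2]
  exact Finset.sum_subset (Finset.subset_univ s) fun a _ ha => hp.2.1 a ha

end

/-- The value of OGP at `s`, as the value of the war of attrition between the arms of positive mean
and the arms of negative mean, the latter listed by decreasing mean. -/
noncomputable def ogpValue [Fintype ι] [DecidableEq ι] (P : Measure Ω) (X : ι → Ω → ℝ)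
    (s : Finset ι) : ℝ :=
  attrition (absMean P X) (reward P X) (above P X s).toList
    (exists_isNegSorting (P := P) (X := X) s).choose

lemma ogpValue_of_above_eq_empty [Fintype ι] [DecidableEq ι] {s : Finset ι}
    (hne : ∀ a, mean P X a ≠ 0) (hs : above P X s = ∅) :
    ogpValue P X s = reward P X s := by
  have h := (exists_isNegSorting (P := P) (X := X) s).choose_spec
  rw [ogpValue, hs, Finset.toList_empty, attrition_nil_left, List.toFinset_eq_of_perm _ _ h.1,
    Finset.toList_toFinset]
  congr 1
  ext a
  rw [mem_neg, and_iff_left_iff_imp]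
  intro ha
  refine lt_of_le_of_ne (not_lt.1 fun h => ?_) (hne a)
  have : a ∈ above P X s := mem_above.2 ⟨ha, h⟩
  simp [hs] at this

section Bellman

variable [Fintype ι] [DecidableEq ι] [IsProbabilityMeasure P] {s : Finset ι}

/-- The value does not depend on the order of the arms of positive mean, nor on the way ties among
the arms of negative mean are broken. -/
lemma ogpValue_eq (hX : ∀ a, Measurable (X a)) (hint : ∀ a, Integrable (X a) P)
    (hindep : iIndepFun X P) (hne : ∀ a, mean P X a ≠ 0) (hord : NegStochOrdered P X)
    {us ds : List ι} (hus : us.Perm (above P X s).toList) (hds : IsNegSorting P X s ds) :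
    ogpValue P X s = attrition (absMean P X) (reward P X) us ds := by
  have hc := absMean_pos hne
  have hs := (exists_isNegSorting (P := P) (X := X) s).choose_spec
  rw [ogpValue, attrition_perm_left hc hus]
  exact le_antisymm
    (attrition_le_of_perm_sorted hc (hds.pairwise_indexLE hX hint hindep hord) hds.nodup
      (hs.1.trans hds.1.symm) _)
    (attrition_le_of_perm_sorted hc (hs.pairwise_indexLE hX hint hindep hord) hs.nodup
      (hds.1.trans hs.1.symm) _)

lemma ogpValue_mix (hX : ∀ a, Measurable (X a)) (hint : ∀ a, Integrable (X a) P)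
    (hindep : iIndepFun X P) (hne : ∀ a, mean P X a ≠ 0) (hord : NegStochOrdered P X)
    {i j : ι} (hi : i ∈ above P X s) (hj : j ∈ neg P X s)
    (hmax : ∀ k ∈ neg P X s, mean P X k ≤ mean P X j) :
    (absMean P X i + absMean P X j) * ogpValue P X s =
      absMean P X i * ogpValue P X (s.erase j) + absMean P X j * ogpValue P X (s.erase i) := by
  obtain ⟨ds, hds⟩ := IsNegSorting.exists_cons hj hmax
  rw [ogpValue_eq hX hint hindep hne hord (cons_perm_above hi) hds,
    attrition_cons_cons (absMean_pos hne),
    ogpValue_eq (s := s.erase j) (us := i :: (above P X (s.erase i)).toList) hX hint hindep hne hord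
      (by rw [above_erase_of_mem_neg hj]; exact cons_perm_above hi)
      (IsNegSorting.of_append_cons (l₁ := []) hds),
    ogpValue_eq (s := s.erase i) hX hint hindep hne hord (List.Perm.refl _) (hds.erase_above hi),
    List.nil_append]

lemma ogpValue_le_erase (hX : ∀ a, Measurable (X a)) (hint : ∀ a, Integrable (X a) P)
    (hindep : iIndepFun X P) (hne : ∀ a, mean P X a ≠ 0) (hord : NegStochOrdered P X)
    {j : ι} (hj : j ∈ neg P X s) (hmax : ∀ k ∈ neg P X s, mean P X k ≤ mean P X j) :
    ogpValue P X s ≤ ogpValue P X (s.erase j) := by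
  obtain ⟨ds, hds⟩ := IsNegSorting.exists_cons hj hmax
  rw [ogpValue_eq hX hint hindep hne hord (List.Perm.refl _) hds,
    ogpValue_eq (s := s.erase j) hX hint hindep hne hord (List.Perm.refl _)
      (IsNegSorting.of_append_cons (l₁ := []) hds), above_erase_of_mem_neg hj]
  exact attrition_cons_right_le (absMean_pos hne)
    (fun S T hST => reward_antitone hX hint hST) j _ ds

lemma ogpValue_index (hX : ∀ a, Measurable (X a)) (hint : ∀ a, Integrable (X a) P)
    (hindep : iIndepFun X P) (hne : ∀ a, mean P X a ≠ 0) (hord : NegStochOrdered P X)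
    {j k : ι} (hj : j ∈ neg P X s) (hmax : ∀ k ∈ neg P X s, mean P X k ≤ mean P X j)
    (hk : k ∈ neg P X s) :
    absMean P X j * (ogpValue P X (s.erase k) - ogpValue P X s) ≤
      absMean P X k * (ogpValue P X (s.erase j) - ogpValue P X s) := by
  rcases eq_or_ne k j with rfl | hkj
  · exact le_rfl
  obtain ⟨ds, hds⟩ := IsNegSorting.exists_cons hj hmax
  have hkds : k ∈ ds := (List.mem_cons.1 (hds.mem_iff.2 hk)).resolve_left hkj
  obtain ⟨m, l, rfl⟩ := List.append_of_mem hkds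
  rw [ogpValue_eq hX hint hindep hne hord (List.Perm.refl _) hds,
    ogpValue_eq (s := s.erase j) hX hint hindep hne hord (List.Perm.refl _)
      (IsNegSorting.of_append_cons (l₁ := []) hds), above_erase_of_mem_neg hj,
    ogpValue_eq (s := s.erase k) hX hint hindep hne hord (List.Perm.refl _)
      (IsNegSorting.of_append_cons (l₁ := j :: m) hds), above_erase_of_mem_neg hk]
  exact attrition_index (p := []) (absMean_pos hne) hds.nodup
    (hds.pairwise_indexLE hX hint hindep hord) _

lemma ogpValue_of_neg_eq_empty (hX : ∀ a, Measurable (X a)) (hint : ∀ a, Integrable (X a) P)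
    (hindep : iIndepFun X P) (hne : ∀ a, mean P X a ≠ 0) (hord : NegStochOrdered P X)
    (hs : neg P X s = ∅) : ogpValue P X s = reward P X ∅ := by
  rw [ogpValue_eq (ds := []) hX hint hindep hne hord (List.Perm.refl _)
    (IsNegSorting.of_mem_iff List.nodup_nil List.Pairwise.nil (by simp [hs])), attrition_nil_right]

end Bellman

/-- The Bellman inequality, by Lagrangian duality: the gain `l` from exploring the best arm of
negative mean, per unit of absolute mean, is a multiplier for the constraint that the expected
reward of the portfolio is nonnegative. -/
lemma sum_mul_ogpValue_erase_le [Fintype ι] [DecidableEq ι] [IsProbabilityMeasure P]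
    (hX : ∀ a, Measurable (X a)) (hint : ∀ a, Integrable (X a) P)
    (hindep : iIndepFun X P) (hne : ∀ a, mean P X a ≠ 0) (hord : NegStochOrdered P X)
    {s : Finset ι} {p : ι → ℝ} (hp : p ∈ MIR P X s) :
    ∑ a ∈ s, p a * ogpValue P X (s.erase a) ≤ ogpValue P X s := by
  have hsum := sum_eq_one_of_mem_MIR hp
  obtain ⟨l, hl0, hl⟩ : ∃ l, 0 ≤ l ∧
      ∀ a ∈ s, ogpValue P X (s.erase a) ≤ ogpValue P X s - l * mean P X a := by
    rcases (neg P X s).eq_empty_or_nonempty with h | h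
    · refine ⟨0, le_rfl, fun a _ => ?_⟩
      have h' : neg P X (s.erase a) = ∅ := by
        refine Finset.eq_empty_of_forall_notMem fun b hb => ?_
        rw [mem_neg, Finset.mem_erase] at hb
        have : b ∈ neg P X s := mem_neg.2 ⟨hb.1.2, hb.2⟩
        simp [h] at this
      rw [ogpValue_of_neg_eq_empty hX hint hindep hne hord h,
        ogpValue_of_neg_eq_empty hX hint hindep hne hord h', zero_mul, sub_zero]
    · obtain ⟨j, hj, hmax⟩ := Finset.exists_max_image (neg P X s) (mean P X) h
      have hcj := absMean_pos hne j
      have h1 := ogpValue_le_erase hX hint hindep hne hord hj hmax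
      refine ⟨(ogpValue P X (s.erase j) - ogpValue P X s) / absMean P X j,
        div_nonneg (sub_nonneg.2 h1) hcj.le, fun a ha => ?_⟩
      refine le_of_mul_le_mul_left ?_ hcj
      have e : absMean P X j * (ogpValue P X s -
          (ogpValue P X (s.erase j) - ogpValue P X s) / absMean P X j * mean P X a) =
          absMean P X j * ogpValue P X s -
            (ogpValue P X (s.erase j) - ogpValue P X s) * mean P X a := by
        field_simp
      rw [e]
      rcases (hne a).lt_or_gt with hlt | hgt
      · have ha' : a ∈ neg P X s := mem_neg.2 ⟨ha, hlt⟩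
        have h2 := ogpValue_index hX hint hindep hne hord hj hmax ha'
        rw [absMean_of_mem_neg ha'] at h2
        linarith
      · have ha' : a ∈ above P X s := mem_above.2 ⟨ha, hgt⟩
        have h2 := ogpValue_mix hX hint hindep hne hord ha' hj hmax
        rw [absMean_of_mem_above ha'] at h2
        linarith
  calc ∑ a ∈ s, p a * ogpValue P X (s.erase a)
      ≤ ∑ a ∈ s, p a * (ogpValue P X s - l * mean P X a) :=
        Finset.sum_le_sum fun a ha => mul_le_mul_of_nonneg_left (hl a ha) (hp.1.1 a)
    _ = (∑ a ∈ s, p a) * ogpValue P X s - l * ∑ a ∈ s, p a * mean P X a := by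
        rw [Finset.sum_mul, Finset.mul_sum, ← Finset.sum_sub_distrib]
        exact Finset.sum_congr rfl fun a _ => by ring
    _ ≤ ogpValue P X s := by
        rw [hsum, one_mul]
        exact sub_le_self _ (mul_nonneg hl0 hp.2.2)

end Value

/-! ### Policies -/

section Policies

variable {ι Ω : Type*} [DecidableEq ι] [MeasurableSpace Ω] {P : Measure Ω} {X : ι → Ω → ℝ}
  {s : Finset ι}

lemma sum_single_mul {i : ι} (hi : i ∈ s) (f : ι → ℝ) : ∑ a ∈ s, single i a * f a = f i := by
  simp [single, hi]

lemma sum_mix_mul {i j : ι} (hi : i ∈ s) (hj : j ∈ s) (hij : i ≠ j) (f : ι → ℝ) :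
    ∑ a ∈ s, mix P X i j a * f a =
      -mean P X j / (mean P X i - mean P X j) * f i +
        mean P X i / (mean P X i - mean P X j) * f j := by
  rw [← Finset.sum_subset (s₁ := {i, j}) (by simp [Finset.insert_subset_iff, hi, hj]),
    Finset.sum_pair hij]
  · simp [mix, hij.symm]
  · intro a _ ha
    simp only [Finset.mem_insert, Finset.mem_singleton, not_or] at ha
    simp [mix, ha.1, ha.2]

variable [Fintype ι]

lemma single_mem_MIR {i : ι} (hi : i ∈ above P X s) : single i ∈ MIR P X s := by
  rw [mem_above] at hi
  refine ⟨⟨fun a => ?_, ?_⟩, fun a ha => ?_, ?_⟩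
  · rw [single]; split_ifs <;> norm_num
  · simpa using sum_single_mul (Finset.mem_univ i) fun _ => (1 : ℝ)
  · rw [single, if_neg (fun e : a = i => ha (e ▸ hi.1))]
  · rw [sum_single_mul hi.1]; exact hi.2.le

lemma mix_mem_MIR {i j : ι} (hi : i ∈ above P X s) (hj : j ∈ neg P X s) :
    mix P X i j ∈ MIR P X s := by
  rw [mem_above] at hi
  rw [mem_neg] at hj
  have hij : i ≠ j := fun e => by subst e; linarith [hi.2, hj.2]
  have hpos : 0 < mean P X i - mean P X j := by linarith
  refine ⟨⟨fun a => ?_, ?_⟩, fun a ha => ?_, ?_⟩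
  · rw [mix]
    split_ifs
    · exact div_nonneg (by linarith) hpos.le
    · exact div_nonneg hi.2.le hpos.le
    · exact le_rfl
  · have := sum_mix_mul (P := P) (X := X) (Finset.mem_univ i) (Finset.mem_univ j) hij
      fun _ => (1 : ℝ)
    simp only [mul_one] at this
    rw [this]
    field_simp
    ring
  · rw [mix, if_neg (fun e : a = i => ha (e ▸ hi.1)), if_neg (fun e : a = j => ha (e ▸ hj.1))]
  · rw [sum_mix_mul hi.1 hj.1 hij]
    refine le_of_eq ?_
    field_simp
    ring

lemma terminal_iff (hne : ∀ a, mean P X a ≠ 0) : Terminal P X s ↔ above P X s = ∅ := by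
  constructor
  · intro h
    refine Finset.eq_empty_of_forall_notMem fun i hi => ?_
    have : single i ∈ MIR P X s := single_mem_MIR hi
    rw [show MIR P X s = ∅ from h] at this
    exact this
  · intro h
    refine Set.eq_empty_of_forall_notMem fun p hp => ?_
    have hneg : ∀ a ∈ s, mean P X a < 0 := fun a ha =>
      lt_of_le_of_ne (not_lt.1 fun h' => by
        have : a ∈ above P X s := mem_above.2 ⟨ha, h'⟩
        simp [h] at this) (hne a)
    have hle : ∀ a ∈ s, p a * mean P X a ≤ 0 := fun a ha =>
      mul_nonpos_of_nonneg_of_nonpos (hp.1.1 a) (hneg a ha).le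
    have h0 := (Finset.sum_eq_zero_iff_of_nonpos hle).1
      (le_antisymm (Finset.sum_nonpos hle) hp.2.2)
    have h1 := sum_eq_one_of_mem_MIR hp
    rw [Finset.sum_eq_zero fun a ha => (mul_eq_zero.1 (h0 a ha)).resolve_right (hne a)] at h1
    exact zero_ne_one h1

lemma exists_isOGP (hne : ∀ a, mean P X a ≠ 0) : ∃ π : Policy ι, IsOGP P X π := by
  have key : ∀ s : Finset ι, ∃ p : ι → ℝ, ¬ Terminal P X s → ∃ i ∈ above P X s,
      (neg P X s = ∅ → p = single i) ∧
      ((neg P X s).Nonempty → ∃ j ∈ neg P X s,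
        (∀ k ∈ neg P X s, mean P X k ≤ mean P X j) ∧ p = mix P X i j) := by
    intro s
    by_cases ht : Terminal P X s
    · exact ⟨0, fun h => absurd ht h⟩
    obtain ⟨i, hi⟩ := Finset.nonempty_iff_ne_empty.2 ((terminal_iff hne).not.1 ht)
    rcases (neg P X s).eq_empty_or_nonempty with h | h
    · exact ⟨single i, fun _ => ⟨i, hi, fun _ => rfl, fun h' => absurd h h'.ne_empty⟩⟩
    · obtain ⟨j, hj, hmax⟩ := Finset.exists_max_image (neg P X s) (mean P X) h
      exact ⟨mix P X i j, fun _ => ⟨i, hi, fun h' => absurd h' h.ne_empty,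
        fun _ => ⟨j, hj, hmax, rfl⟩⟩⟩
  choose π hπ using key
  exact ⟨π, hπ⟩

lemma IsPValid.isMIR {π : Policy ι} (h : IsPValid P X π) : IsMIR P X π := fun s hs => (h s hs).1

lemma IsOGP.isPValid {π : Policy ι} (h : IsOGP P X π) : IsPValid P X π := by
  intro s hs
  obtain ⟨i, hi, h0, h1⟩ := h s hs
  have hi' : i ∈ above P X Finset.univ := mem_above.2 ⟨Finset.mem_univ _, (mem_above.1 hi).2⟩
  refine ⟨?_, fun hn => ?_, fun hn => ⟨i, hi', h0 hn⟩⟩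
  · rcases (neg P X s).eq_empty_or_nonempty with hn | hn
    · rw [h0 hn]
      exact single_mem_MIR hi
    · obtain ⟨j, hj, _, e⟩ := h1 hn
      rw [e]
      exact mix_mem_MIR hi hj
  · obtain ⟨j, hj, _, e⟩ := h1 hn
    exact ⟨i, hi', j, mem_neg.2 ⟨Finset.mem_univ _, (mem_neg.1 hj).2⟩, e⟩

/-- A right-ordered policy for decreasing means is an instance of OGP. -/
lemma IsRightOrdered.isOGP {π : Policy ι}
    {σ : {a // a ∈ neg P X Finset.univ} ≃ Fin (neg P X Finset.univ).card}
    (h : IsRightOrdered P X π σ) (hσ : DecreasingMean P X σ) : IsOGP P X π := by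
  intro s hs
  rcases (neg P X s).eq_empty_or_nonempty with hn | hn
  · obtain ⟨hmem, _, hsing⟩ := h.1 s hs
    obtain ⟨i, hi, e⟩ := hsing hn
    refine ⟨i, mem_above.2 ⟨?_, (mem_above.1 hi).2⟩, fun _ => e, fun h' => absurd hn h'.ne_empty⟩
    by_contra his
    -- A portfolio at `s` vanishes outside `s`.
    have := hmem.2.1 i his
    simp [e, single] at this
  · obtain ⟨i, hi, j, hj, hmin, e⟩ := h.2 s hs hn
    refine ⟨i, hi, fun h' => absurd h' hn.ne_empty, fun _ => ⟨j, ?_, fun k hk => ?_, e⟩⟩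
    · exact mem_neg.2 ⟨hj, (mem_neg.1 j.2).2⟩
    · rw [mem_neg] at hk
      have hle := hmin ⟨k, mem_neg.2 ⟨Finset.mem_univ _, hk.2⟩⟩ hk.1
      rcases hle.lt_or_eq with hlt | heq
      · exact hσ _ _ hlt
      · rw [σ.injective heq]

lemma W_eq_WH (π : Policy ι) (h : History ι) (s : Finset ι) :
    W P X π s = WH P X (fun _ => π) h s := by
  induction s using Finset.strongInduction generalizing h with
  | H s ih =>
    rw [W, WH]
    split_ifs with ht
    · rfl
    · exact Finset.sum_congr rfl fun a _ => by rw [← ih _ (Finset.erase_ssubset a.2)]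

section Optimality

variable [IsProbabilityMeasure P]

lemma WH_le_ogpValue (hX : ∀ a, Measurable (X a)) (hint : ∀ a, Integrable (X a) P)
    (hindep : iIndepFun X P) (hne : ∀ a, mean P X a ≠ 0) (hord : NegStochOrdered P X)
    {π : HPolicy ι} (hπ : IsMIRH P X π) (h : History ι) (s : Finset ι) :
    WH P X π h s ≤ ogpValue P X s := by
  induction s using Finset.strongInduction generalizing h with
  | H s ih =>
    rw [WH]
    split_ifs with ht
    · exact (ogpValue_of_above_eq_empty hne ((terminal_iff hne).1 ht)).ge
    · have hp := hπ h s ht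
      refine le_trans ?_ (sum_mul_ogpValue_erase_le hX hint hindep hne hord hp)
      rw [← Finset.sum_coe_sort s]
      exact Finset.sum_le_sum fun a _ =>
        mul_le_mul_of_nonneg_left (ih _ (Finset.erase_ssubset a.2) _) (hp.1.1 a)

lemma IsOGP.W_eq_ogpValue (hX : ∀ a, Measurable (X a)) (hint : ∀ a, Integrable (X a) P)
    (hindep : iIndepFun X P) (hne : ∀ a, mean P X a ≠ 0) (hord : NegStochOrdered P X)
    {π : Policy ι} (hπ : IsOGP P X π) (s : Finset ι) : W P X π s = ogpValue P X s := by
  induction s using Finset.strongInduction with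
  | H s ih =>
    rw [W]
    split_ifs with ht
    · exact (ogpValue_of_above_eq_empty hne ((terminal_iff hne).1 ht)).symm
    · rw [Finset.sum_congr rfl fun (a : s) _ => by rw [ih _ (Finset.erase_ssubset a.2)],
        Finset.sum_coe_sort s fun a => π s a * ogpValue P X (s.erase a)]
      obtain ⟨i, hi, h0, h1⟩ := hπ s ht
      have his := (mem_above.1 hi).1
      rcases (neg P X s).eq_empty_or_nonempty with hn | hn
      · rw [h0 hn, sum_single_mul his, ogpValue_of_neg_eq_empty hX hint hindep hne hord hn,
          ogpValue_of_neg_eq_empty hX hint hindep hne hord]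
        refine Finset.eq_empty_of_forall_notMem fun b hb => ?_
        rw [mem_neg, Finset.mem_erase] at hb
        have : b ∈ neg P X s := mem_neg.2 ⟨hb.1.2, hb.2⟩
        simp [hn] at this
      · obtain ⟨j, hj, hmax, e⟩ := h1 hn
        have hi2 := (mem_above.1 hi).2
        obtain ⟨hjs, hj2⟩ := mem_neg.1 hj
        have h := ogpValue_mix hX hint hindep hne hord hi hj hmax
        rw [absMean_of_mem_above hi, absMean_of_mem_neg hj] at h
        rw [e, sum_mix_mul his hjs (fun e => by subst e; linarith)]
        have hpos : mean P X i - mean P X j ≠ 0 := by linarith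
        field_simp
        linear_combination -h

lemma IsOGP.optimalFrom (hX : ∀ a, Measurable (X a)) (hint : ∀ a, Integrable (X a) P)
    (hindep : iIndepFun X P) (hne : ∀ a, mean P X a ≠ 0) (hord : NegStochOrdered P X)
    {π : Policy ι} (hπ : IsOGP P X π) (s : Finset ι) : OptimalFrom P X π s := by
  have hW := hπ.W_eq_ogpValue hX hint hindep hne hord s
  have hMIR := hπ.isPValid.isMIR
  have h1 : IsGreatest (values P X s) (W P X π s) := by
    refine ⟨⟨π, hMIR, rfl⟩, ?_⟩
    rintro _ ⟨π', hπ', rfl⟩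
    rw [hW, W_eq_WH π' []]
    exact WH_le_ogpValue hX hint hindep hne hord (fun _ => hπ') [] s
  have h2 : IsGreatest (valuesH P X s) (W P X π s) := by
    refine ⟨⟨fun _ => π, fun _ => hMIR, (W_eq_WH π [] s).symm⟩, ?_⟩
    rintro _ ⟨π', hπ', rfl⟩
    rw [hW]
    exact WH_le_ogpValue hX hint hindep hne hord hπ' [] s
  exact ⟨h1.bddAbove, h2.bddAbove, h1.csSup_eq.symm, h2.csSup_eq.symm⟩

end Optimality

end Policies

end GMDP

theorem theorem1 {ι Ω : Type*} [Fintype ι] [DecidableEq ι] [MeasurableSpace Ω]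
    (P : Measure Ω) [IsProbabilityMeasure P] (X : ι → Ω → ℝ)
    (hX : ∀ a, Measurable (X a)) (hint : ∀ a, Integrable (X a) P)
    (hindep : iIndepFun X P) (hne : ∀ a, GMDP.mean P X a ≠ 0)
    (hord : GMDP.NegStochOrdered P X) :
    (∃ π : GMDP.Policy ι, GMDP.IsOGP P X π) ∧
    (∀ π : GMDP.Policy ι, GMDP.IsOGP P X π →
      GMDP.IsPValid P X π ∧ GMDP.IsMIR P X π ∧
        GMDP.W P X π Finset.univ = GMDP.WStar P X Finset.univ ∧
        ∀ s : Finset ι, GMDP.OptimalFrom P X π s) ∧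
    (∀ (π : GMDP.Policy ι)
      (σ : {a // a ∈ GMDP.neg P X Finset.univ} ≃ Fin (GMDP.neg P X Finset.univ).card),
      GMDP.IsRightOrdered P X π σ → GMDP.DecreasingMean P X σ →
        GMDP.IsMIR P X π ∧ ∀ s : Finset ι, GMDP.OptimalFrom P X π s) := by
  refine ⟨GMDP.exists_isOGP hne, fun π hπ => ?_, fun π σ hπ hσ => ?_⟩
  · have hopt := hπ.optimalFrom hX hint hindep hne hord
    exact ⟨hπ.isPValid, hπ.isPValid.isMIR, (hopt Finset.univ).2.2.1, hopt⟩
  · exact ⟨hπ.1.isMIR, (hπ.isOGP hσ).optimalFrom hX hint hindep hne hord⟩
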